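/- **Lemma 4.3.** Let $Y$ be a finite discrete topological group with at least two elements, $\Gamma$ a nonempty set and $\varphi:\Gamma\to\Gamma$ a map; let $\sigma_\varphi:Y^\Gamma\to Y^\Gamma$, $\sigma_\varphi((x_\alpha)_{\alpha\in\Gamma})=(x_{\varphi(\alpha)})_{\alpha\in\Gamma}$, be the generalized shift, where $Y^\Gamma$ has the product topology. Assume that $\varphi$ and $\sigma_\varphi$ are both finite fibre (every point has only finitely many preimages). Let $\bigoplus_\Gamma Y\subseteq Y^\Gamma$ be the subgroup of all families that equal the identity at all but finitely many indices; $\sigma_\varphi$ maps it to itself. Then $$\mathrm{ent}_{\rm top}(\sigma_\varphi)\le \mathrm{ent}_{\rm cset}(\sigma_\varphi)\le \mathrm{ent}_{\rm set}(\sigma_\varphi)\qquad\text{and}\qquad \mathrm{ent}_{\rm alg}\bigl(\sigma_\varphi\restriction_{\bigoplus_\Gamma Y}\bigr)\le \mathrm{ent}_{\rm set}(\sigma_\varphi).$$ In particular, if $\mathrm{ent}_{\rm top}(\sigma_\varphi)>0$ then $\mathrm{ent}_{\rm cset}(\sigma_\varphi)>0$; if $\mathrm{ent}_{\rm cset}(\sigma_\varphi)>0$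 then $\mathrm{ent}_{\rm set}(\sigma_\varphi)>0$; and if $\mathrm{ent}_{\rm alg}(\sigma_\varphi\restriction_{\bigoplus_\Gamma Y})>0$ then $\mathrm{ent}_{\rm set}(\sigma_\varphi)>0$. Here all entropies take values in $[0,\infty]$ and are defined as follows (all the limits exist in $[0,\infty]$). - For $g:A\to A$, $\mathrm{ent}_{\rm set}(g)$ is the supremum, over the finite subsets $D$ of $A$, of $\lim_{n\to\infty}\frac1n\,|D\cup g(D)\cup\dots\cup g^{n-1}(D)|$. - For a finite fibre map $k:A\to A$ let $\mathrm{sc}(k)=\bigcap_{n\ge1}k^n(A)$ and $g=k\restriction_{\mathrm{sc}(k)}:\mathrm{sc}(k)\to\mathrm{sc}(k)$; then $\mathrm{ent}_{\rm cset}(k)$ is the supremum, over the finite subsets $D$ of $\mathrm{sc}(k)$, of $\lim_{n\to\infty}\frac1n\,|D\cup g^{-1}(D)\cup\dots\cup g^{-(n-1)}(D)|$. - For a continuous self-map $T$ of a compact space, $\mathrm{ent}_{\rm top}(T)$ is the supremum, over the finite open covers $\mathcal U$, of $\lim_{n\to\infty}\frac1n\log N(\mathcal U\vee T^{-1}(\mathcal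 U)\vee\dots\vee T^{-(n-1)}(\mathcal U))$, where $\mathcal U\vee\mathcal V=\{U\cap V:U\in\mathcal U,V\in\mathcal V\}$ and $N(\mathcal U)$ is the least cardinality of a finite subcover of $\mathcal U$. - For an endomorphism $\theta$ of a group $G$, $\mathrm{ent}_{\rm alg}(\theta)$ is the supremum, over the finite subgroups $H$ of $G$, of $\lim_{n\to\infty}\frac1n\log|H\cdot\theta(H)\cdots\theta^{n-1}(H)|$, where the product of sets is the set of all products (if $G$ is abelian and written additively, it is $H+\theta(H)+\dots+\theta^{n-1}(H)$). -/

import Mathlib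

open scoped ENNReal Pointwise

noncomputable section

namespace GenShift

/-- The generalized shift `σ_φ : Y^Γ → Y^Γ`, `(x_α)_α ↦ (x_{φ(α)})_α`. -/
def shift {Γ Y : Type*} (φ : Γ → Γ) : (Γ → Y) → (Γ → Y) := fun x α => x (φ α)

/-- A self-map is finite fibre if every point has finitely many preimages. -/
def FiniteFibre {A : Type*} (g : A → A) : Prop := ∀ a, (g ⁻¹' {a}).Finite

/-! ### Set-theoretical entropy -/

/-- `ent_set(g, D) = lim |D ∪ g(D) ∪ ⋯ ∪ g^{n-1}(D)| / n`. The limit always exists, since the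
numerator is subadditive in `n`; the upper limit is its value. -/
def setEntropyOn {A : Type*} (g : A → A) (D : Set A) : ℝ≥0∞ :=
  Filter.limsup (fun n : ℕ => ((⋃ i < n, g^[i] '' D).encard : ℝ≥0∞) / n) Filter.atTop

/-- `ent_set(g)`: the supremum of `ent_set(g, D)` over the finite subsets `D`. -/
def setEntropy {A : Type*} (g : A → A) : ℝ≥0∞ := ⨆ D : Finset A, setEntropyOn g (D : Set A)

/-! ### Contravariant set-theoretical entropy -/

/-- `ent_cset(g, D) = lim |D ∪ g⁻¹(D) ∪ ⋯ ∪ g^{-(n-1)}(D)| / n`, to be used for onto finite fibre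
maps `g` and finite `D`. In that case the limit exists in `[0, ∞]`, since the increments of the
numerator are eventually nondecreasing; the upper limit is its value. -/
def csetEntropyOn {A : Type*} (g : A → A) (D : Set A) : ℝ≥0∞ :=
  Filter.limsup (fun n : ℕ => ((⋃ i < n, g^[i] ⁻¹' D).encard : ℝ≥0∞) / n) Filter.atTop

/-- The surjective cover `sc(k) = ⋂_{n ≥ 1} k^n(A)`. -/
def surjCover {A : Type*} (k : A → A) : Set A := ⋂ n : ℕ, ⋂ _ : 1 ≤ n, Set.range k^[n]

theorem mapsTo_surjCover {A : Type*} (k : A → A) :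
    Set.MapsTo k (surjCover k) (surjCover k) := by
  intro x hx
  simp only [surjCover, Set.mem_iInter] at hx ⊢
  intro n hn
  obtain ⟨y, rfl⟩ := hx n hn
  exact ⟨k y, by rw [← Function.iterate_succ_apply, Function.iterate_succ_apply']⟩

/-- The restriction `k ↾ sc(k) : sc(k) → sc(k)`. -/
def surjCoverMap {A : Type*} (k : A → A) : surjCover k → surjCover k :=
  (mapsTo_surjCover k).restrict k (surjCover k) (surjCover k)

/-- `ent_cset(k)` of a finite fibre map `k`: the supremum of `ent_cset(k ↾ sc(k), D)` over the
finite subsets `D` of `sc(k)`. -/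
def csetEntropy {A : Type*} (k : A → A) : ℝ≥0∞ :=
  ⨆ D : Finset (surjCover k), csetEntropyOn (surjCoverMap k) (D : Set (surjCover k))

/-! ### Topological entropy, through open covers -/

/-- The join `𝒰 ∨ 𝒱 = {U ∩ V : U ∈ 𝒰, V ∈ 𝒱}`. -/
def coverJoin {X : Type*} (𝒰 𝒱 : Set (Set X)) : Set (Set X) :=
  Set.image2 (fun U V => U ∩ V) 𝒰 𝒱

/-- `𝒰 ∨ T⁻¹(𝒰) ∨ ⋯ ∨ T^{-(n-1)}(𝒰)` (the empty join is the trivial cover). -/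
def iterJoin {X : Type*} (T : X → X) (𝒰 : Set (Set X)) : ℕ → Set (Set X)
  | 0 => {Set.univ}
  | n + 1 => coverJoin (iterJoin T 𝒰 n) ((fun U => T^[n] ⁻¹' U) '' 𝒰)

/-- `N(𝒰)`: the least cardinality of a finite subcover of the cover `𝒰`. -/
def minSubcover {X : Type*} (𝒰 : Set (Set X)) : ℕ :=
  sInf {k | ∃ 𝒲 : Finset (Set X), (𝒲 : Set (Set X)) ⊆ 𝒰 ∧
    ⋃₀ (𝒲 : Set (Set X)) = Set.univ ∧ 𝒲.card = k}

/-- `ent_top(T, 𝒰) = lim log N(𝒰 ∨ T⁻¹(𝒰) ∨ ⋯ ∨ T^{-(n-1)}(𝒰)) / n`; for a finite cover the limit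
exists by subadditivity, and the upper limit is its value. -/
def topEntropyOn {X : Type*} (T : X → X) (𝒰 : Set (Set X)) : ℝ≥0∞ :=
  Filter.limsup (fun n : ℕ => ENNReal.ofReal (Real.log (minSubcover (iterJoin T 𝒰 n)) / n))
    Filter.atTop

/-- `ent_top(T)`: the supremum of `ent_top(T, 𝒰)` over the finite open covers `𝒰` of `X`. -/
def topEntropy {X : Type*} [TopologicalSpace X] (T : X → X) : ℝ≥0∞ :=
  ⨆ (𝒰 : Set (Set X)) (_ : 𝒰.Finite ∧ (∀ U ∈ 𝒰, IsOpen U) ∧ ⋃₀ 𝒰 = Set.univ), topEntropyOn T 𝒰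

/-! ### Algebraic entropy -/

/-- The trajectory `H · θ(H) ⋯ θ^{n-1}(H)`, a product of sets (written
`H + θ(H) + ⋯ + θ^{n-1}(H)` in an additive group). -/
def trajectory {G : Type*} [Group G] (θ : G →* G) (H : Set G) : ℕ → Set G
  | 0 => 1
  | n + 1 => trajectory θ H n * (θ^[n] '' H)

/-- `ent_alg(θ, H) = lim log |H · θ(H) ⋯ θ^{n-1}(H)| / n`; for a finite nonempty `H` the limit exists
by subadditivity, and the upper limit is its value. -/
def algEntropyOn {G : Type*} [Group G] (θ : G →* G) (H : Set G) : ℝ≥0∞ :=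
  Filter.limsup (fun n : ℕ => ENNReal.ofReal (Real.log ((trajectory θ H n).ncard) / n))
    Filter.atTop

/-- `ent_alg(θ)`: the supremum of `ent_alg(θ, H)` over the finite subgroups `H`. -/
def algEntropy {G : Type*} [Group G] (θ : G →* G) : ℝ≥0∞ :=
  ⨆ (H : Subgroup G) (_ : (H : Set G).Finite), algEntropyOn θ (H : Set G)

/-- The direct sum `⊕_Γ Y` inside `Y^Γ`: the families that are the identity at all but finitely
many indices. -/
def directSum (Γ Y : Type*) [Group Y] : Subgroup (Γ → Y) where
  carrier := {x | {α | x α ≠ 1}.Finite}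
  one_mem' := by simp
  mul_mem' {x y} hx hy := by
    refine (Set.Finite.union hx hy).subset fun α hα => ?_
    by_contra h
    simp only [Set.mem_union, Set.mem_ofPred_eq, not_or, not_not] at h
    exact hα (by simp [h.1, h.2])
  inv_mem' {x} hx := by simpa using hx

/-- The restriction of `σ_φ` to `⊕_Γ Y`, as a group endomorphism; it is defined because `φ` is finite
fibre. -/
def directSumShift {Γ : Type*} (Y : Type*) [Group Y] (φ : Γ → Γ) (hφ : FiniteFibre φ) :
    directSum Γ Y →* directSum Γ Y where
  toFun x := ⟨shift φ x.1, Set.Finite.preimage' x.2 fun a _ => hφ a⟩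
  map_one' := rfl
  map_mul' _ _ := rfl

end GenShift

end

open scoped ENNReal
open Filter Topology Function

/-! Every entropy on the larger side is infinite unless the smaller one vanishes, and the dynamics
of φ decides which. If some φ-orbit is infinite, both `csetEntropy` and `setEntropy` of the shift
are ⊤. If all orbits are finite, `topEntropy` is 0, because an open cover and its pullbacks see only
finitely many coordinates. Then either φ^p = φ^q for some p < q, which kills `csetEntropy` and
`algEntropy`, or distinct iterates differ at infinitely many points and `setEntropy` is ⊤. The
infinite values of `setEntropy` come from a Baire category argument (`exists_shift_independent`),
which needs only that distinct iterates of φ differ infinitely often. -/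

namespace GenShift

/-! ### Preperiodicity and coincidence of iterates -/

section Iterates

variable {A : Type*} {f : A → A}

/-- An exponent i ≥ q can be lowered by q - p. The resulting i' depends on p, q, i but not on x. -/
theorem exists_lt_iterate_eq {p q : ℕ} (hpq : p < q) (i : ℕ) :
    ∃ i' < q, ∀ x, f^[p] x = f^[q] x → f^[i] x = f^[i'] x := by
  induction i using Nat.strong_induction_on with
  | _ i ih =>
    rcases lt_or_ge i q with hi | hi
    · exact ⟨i, hi, fun _ _ => rfl⟩
    · obtain ⟨i', hi', h⟩ := ih (i - q + p) (by omega)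
      refine ⟨i', hi', fun x hx => ?_⟩
      rw [← h x hx, iterate_add_apply, hx, ← iterate_add_apply, Nat.sub_add_cancel hi]

theorem FiniteFibre.iterate (hf : FiniteFibre f) (n : ℕ) : FiniteFibre f^[n] := by
  induction n with
  | zero => intro a; simp
  | succ n ih =>
    intro a
    rw [iterate_succ, Set.preimage_comp]
    exact (ih a).preimage' fun b _ => hf b

theorem exists_isPeriodicPt_iterate_union {S S' : Set A}
    (h : ∃ p r, 0 < r ∧ ∀ x ∈ S, IsPeriodicPt f r (f^[p] x))
    (h' : ∃ p r, 0 < r ∧ ∀ x ∈ S', IsPeriodicPt f r (f^[p] x)) :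
    ∃ p r, 0 < r ∧ ∀ x ∈ S ∪ S', IsPeriodicPt f r (f^[p] x) := by
  obtain ⟨p, r, hr, h⟩ := h
  obtain ⟨p', r', hr', h'⟩ := h'
  refine ⟨p + p', r * r', Nat.mul_pos hr hr', ?_⟩
  rintro x (hx | hx)
  · rw [add_comm, iterate_add_apply]
    exact ((h x hx).apply_iterate p').mul_const r'
  · rw [iterate_add_apply]
    exact ((h' x hx).apply_iterate p).const_mul r

theorem isPeriodicPt_iterate_of_eq {p q : ℕ} (hpq : p < q) {x : A} (h : f^[p] x = f^[q] x) :
    IsPeriodicPt f (q - p) (f^[p] x) := by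
  rw [IsPeriodicPt, IsFixedPt, ← iterate_add_apply, Nat.sub_add_cancel hpq.le, h]

theorem exists_isPeriodicPt_iterate_of_finite (hf : ∀ x, ¬ Injective fun n => f^[n] x)
    {S : Set A} (hS : S.Finite) : ∃ p r, 0 < r ∧ ∀ x ∈ S, IsPeriodicPt f r (f^[p] x) := by
  induction S, hS using Set.Finite.induction_on with
  | empty => exact ⟨0, 1, one_pos, by simp⟩
  | @insert a s _ _ ih =>
    rw [Set.insert_eq]
    refine exists_isPeriodicPt_iterate_union ?_ ih
    have := hf a
    simp only [Injective, not_forall] at this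
    obtain ⟨p, q, h, hne⟩ := this
    rcases lt_or_gt_of_ne hne with hlt | hlt
    · exact ⟨p, q - p, by omega, by simpa using isPeriodicPt_iterate_of_eq hlt h⟩
    · exact ⟨q, p - q, by omega, by simpa using isPeriodicPt_iterate_of_eq hlt h.symm⟩

/-- If all orbits are finite and no two distinct iterates agree, then any two distinct iterates
differ at infinitely many points. -/
theorem infinite_iterate_ne (hf : ∀ x, ¬ Injective fun n => f^[n] x)
    (hne : ∀ p q, p < q → f^[p] ≠ f^[q]) {p q : ℕ} (hpq : p < q) :
    {x | f^[p] x ≠ f^[q] x}.Infinite := by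
  intro hfin
  -- A finite exceptional set has a common preperiod and period, and so does its complement; merging
  -- the two makes two iterates agree everywhere.
  obtain ⟨a, r, hr, h⟩ := exists_isPeriodicPt_iterate_union
    (exists_isPeriodicPt_iterate_of_finite hf hfin)
    (S' := {x | f^[p] x = f^[q] x})
    ⟨p, q - p, by omega, fun x hx => isPeriodicPt_iterate_of_eq hpq hx⟩
  refine hne a (r + a) (by omega) (funext fun x => ?_)
  rw [iterate_add_apply]
  refine (h x ?_).symm
  by_cases hx : f^[p] x = f^[q] x
  · exact Or.inr hx
  · exact Or.inl hx

theorem infinite_iterate_ne_of_injective {x : A} (hx : Injective fun n => f^[n] x) {p q : ℕ}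
    (hpq : p < q) : {x | f^[p] x ≠ f^[q] x}.Infinite := by
  refine (Set.infinite_range_of_injective hx).mono ?_
  rintro _ ⟨n, rfl⟩ h
  simp only [← iterate_add_apply] at h
  have := hx h
  omega

end Iterates

theorem shift_iterate {Γ Y : Type*} (φ : Γ → Γ) (n : ℕ) (x : Γ → Y) :
    (shift φ)^[n] x = x ∘ φ^[n] := by
  induction n generalizing x with
  | zero => rfl
  | succ n ih =>
    rw [iterate_succ_apply, ih, iterate_succ']
    rfl

/-! ### Generic points with independent orbits -/

section Baire

variable {Γ Δ Y : Type*} [Nontrivial Y]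

/-- A basic open set restricts finitely many coordinates. As u has finite fibres, some γ with u γ ≠
v γ has u γ outside them, and the value at u γ can be changed freely. -/
theorem dense_comp_ne [TopologicalSpace Y] [DiscreteTopology Y] {u v : Γ → Δ}
    (hu : ∀ d, (u ⁻¹' {d}).Finite) (huv : {γ | u γ ≠ v γ}.Infinite) :
    Dense {x : Δ → Y | x ∘ u ≠ x ∘ v} := by
  classical
  refine dense_iff_inter_open.2 fun U hU ⟨x, hx⟩ => ?_
  obtain ⟨F, t, ht, hsub⟩ := isOpen_pi_iff.1 hU x hx
  obtain ⟨γ, hγ, hγF⟩ := huv.exists_notMem_finite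
    ((F.finite_toSet).preimage' fun b _ => hu b)
  obtain ⟨y, hy⟩ := exists_ne (x (v γ))
  refine ⟨update x (u γ) y, hsub fun d hd => ?_, fun h => ?_⟩
  · rw [update_of_ne]
    · exact (ht d hd).2
    · rintro rfl
      exact hγF hd
  · have := congrFun h γ
    simp only [comp_apply, update_self, update_of_ne (Ne.symm hγ)] at this
    exact hy this

/-- A Baire category argument: infinitely many points whose orbits under the generalized shift are
infinite and pairwise disjoint. -/
theorem exists_shift_independent [Finite Y] {φ : Γ → Γ} (hφ : FiniteFibre φ)
    (h : ∀ p q, p < q → {γ | φ^[p] γ ≠ φ^[q] γ}.Infinite) :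
    ∃ x : ℕ → Γ → Y, ∀ p q j k, (shift φ)^[p] (x j) = (shift φ)^[q] (x k) → p = q ∧ j = k := by
  let : TopologicalSpace Y := ⊥
  have : DiscreteTopology Y := ⟨rfl⟩
  have hΓ : Infinite Γ := Set.infinite_univ_iff.1 ((h 0 1 one_pos).mono (Set.subset_univ _))
  -- A sequence in Y^Γ is a single point x of Y^(ℕ × Γ), and x ∘ u (p, j) is the p-th shift of its
  -- j-th term.
  let u : ℕ × ℕ → Γ → ℕ × Γ := fun a γ => (a.2, φ^[a.1] γ)
  have hu : ∀ a b, (u a ⁻¹' {b}).Finite := fun a b =>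
    (hφ.iterate a.1 b.2).subset fun _ hγ => congrArg Prod.snd hγ
  have huv : ∀ a b, a ≠ b → {γ | u a γ ≠ u b γ}.Infinite := by
    rintro ⟨p, j⟩ ⟨q, k⟩ hab
    by_cases hjk : j = k
    · subst hjk
      have hpq : p ≠ q := fun e => hab (by rw [e])
      rcases lt_or_gt_of_ne hpq with hlt | hlt
      · refine (h p q hlt).mono fun γ (hγ : φ^[p] γ ≠ φ^[q] γ) e => ?_
        exact hγ (congrArg Prod.snd e)
      · refine (h q p hlt).mono fun γ (hγ : φ^[q] γ ≠ φ^[p] γ) e => ?_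
        exact hγ (congrArg Prod.snd e).symm
    · exact Set.infinite_univ.mono fun γ _ e => hjk (congrArg Prod.fst e)
  have hdense : Dense (⋂ c : {c : (ℕ × ℕ) × (ℕ × ℕ) // c.1 ≠ c.2},
      {x : ℕ × Γ → Y | x ∘ u c.1.1 ≠ x ∘ u c.1.2}) := by
    refine dense_iInter_of_isOpen (fun c => ?_) fun c => dense_comp_ne (hu _) (huv _ _ c.2)
    refine isOpen_ne_fun ?_ ?_ <;> fun_prop
  obtain ⟨x, hx⟩ := hdense.nonempty
  refine ⟨fun j γ => x (j, γ), fun p q j k e => ?_⟩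
  by_contra hne
  refine Set.mem_iInter.1 hx ⟨((p, j), (q, k)), fun e' => hne ?_⟩ ?_
  · simpa using e'
  · rw [shift_iterate, shift_iterate] at e
    exact e

end Baire

/-! ### Criteria for infinite and zero entropy -/

section Growth

theorem limsup_encard_div_eq_zero {A : Type*} {s : ℕ → Set A} {E : Set A} (hE : E.Finite)
    (hs : ∀ n, s n ⊆ E) :
    limsup (fun n : ℕ => ((s n).encard : ℝ≥0∞) / n) atTop = 0 := by
  refine Tendsto.limsup_eq (tendsto_of_tendsto_of_tendsto_of_le_of_le tendsto_const_nhds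
    (?_ : Tendsto (fun n : ℕ => (E.encard : ℝ≥0∞) / n) atTop (𝓝 0)) (fun _ => zero_le) ?_)
  · have hfin : (E.encard : ℝ≥0∞) ≠ ⊤ := by simpa using hE
    simpa using ENNReal.Tendsto.const_div ENNReal.tendsto_nat_nhds_top (Or.inr hfin)
  · intro n
    have := Set.encard_le_encard (hs n)
    dsimp only
    gcongr

theorem limsup_log_div_eq_zero {f : ℕ → ℕ} {C : ℕ} (hf : ∀ n, f n ≤ C) :
    limsup (fun n : ℕ => ENNReal.ofReal (Real.log (f n) / n)) atTop = 0 := by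
  refine Tendsto.limsup_eq (tendsto_of_tendsto_of_tendsto_of_le_of_le tendsto_const_nhds
    (?_ : Tendsto (fun n : ℕ => ENNReal.ofReal (Real.log C / n)) atTop (𝓝 0))
    (fun _ => zero_le) ?_)
  · rw [← ENNReal.ofReal_zero]
    exact ENNReal.tendsto_ofReal (tendsto_const_div_atTop_nhds_zero_nat _)
  · intro n
    dsimp only
    rcases Nat.eq_zero_or_pos (f n) with h0 | h0
    · simp [h0]
    · have := hf n
      gcongr

theorem le_limsup_encard_div {A : Type*} {s : ℕ → Set A} {m : ℕ} (z : ℕ → ℕ → A)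
    (hz : ∀ p q j k, z p j = z q k → p = q ∧ j = k)
    (hs : ∀ n, ∀ p < n, ∀ j < m, z p j ∈ s n) :
    (m : ℝ≥0∞) ≤ limsup (fun n : ℕ => ((s n).encard : ℝ≥0∞) / n) atTop := by
  refine le_limsup_of_frequently_le (Eventually.frequently ?_) (by isBoundedDefault)
  filter_upwards [eventually_ge_atTop 1] with n hn
  rw [ENNReal.le_div_iff_mul_le (by simp; omega) (by simp)]
  let w : ℕ × ℕ → A := fun a => z a.1 a.2
  have hw : Injective w := fun a b hab => by
    obtain ⟨h1, h2⟩ := hz _ _ _ _ hab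
    exact Prod.ext h1 h2
  have hsub : w '' ((Finset.range n ×ˢ Finset.range m : Finset (ℕ × ℕ)) : Set (ℕ × ℕ)) ⊆ s n := by
    rintro _ ⟨a, ha, rfl⟩
    simp only [Finset.coe_product, Finset.coe_range, Set.mem_prod, Set.mem_Iio] at ha
    exact hs n _ ha.1 _ ha.2
  have := Set.encard_le_encard hsub
  rw [hw.encard_image, Set.encard_coe_eq_coe_finsetCard, Finset.card_product, Finset.card_range,
    Finset.card_range] at this
  calc (m : ℝ≥0∞) * n = (((n * m : ℕ) : ℕ∞) : ℝ≥0∞) := by push_cast; ring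
    _ ≤ _ := by exact_mod_cast this

variable {A : Type*}

theorem setEntropy_eq_top {g : A → A} (x : ℕ → A)
    (hx : ∀ p q j k, g^[p] (x j) = g^[q] (x k) → p = q ∧ j = k) : setEntropy g = ⊤ := by
  classical
  refine ENNReal.eq_top_of_forall_nnreal_le fun r => ?_
  obtain ⟨m, hm⟩ := exists_nat_ge r
  refine le_trans (b := (m : ℝ≥0∞)) (by exact_mod_cast hm) ?_
  refine le_trans ?_ (le_iSup _ ((Finset.range m).image x))
  refine le_limsup_encard_div (fun p j => g^[p] (x j)) hx fun n p hp j hj => ?_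
  simp only [Set.mem_iUnion]
  exact ⟨p, hp, x j, by simpa using ⟨j, hj, rfl⟩, rfl⟩

theorem coe_surjCoverMap_iterate (k : A → A) (n : ℕ) (x : surjCover k) :
    ((surjCoverMap k)^[n] x : A) = k^[n] x := by
  induction n generalizing x with
  | zero => rfl
  | succ n ih => rw [iterate_succ_apply, iterate_succ_apply, ih]; rfl

/-- Each z · j is a backward orbit of z 0 j, so it lies in the surjective cover. Applying k^q to a
coincidence z p i = z q j with p ≤ q turns it into one between forward orbits. -/
theorem csetEntropy_eq_top {k : A → A} (z : ℕ → ℕ → A)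
    (hz : ∀ m n j, k^[m] (z (n + m) j) = z n j)
    (hx : ∀ p q i j, k^[p] (z 0 i) = k^[q] (z 0 j) → p = q ∧ i = j) : csetEntropy k = ⊤ := by
  classical
  have hmem : ∀ n j, z n j ∈ surjCover k := fun n j => by
    simp only [surjCover, Set.mem_iInter]
    exact fun m _ => ⟨_, hz m n j⟩
  have hz0 : ∀ n j, k^[n] (z n j) = z 0 j := fun n j => by simpa using hz n 0 j
  have key : ∀ p q i j, p ≤ q → z p i = z q j → p = q ∧ i = j := fun p q i j hpq h => by
    have : k^[q - p] (z 0 i) = k^[0] (z 0 j) := by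
      rw [← hz0 p i, h, ← iterate_add_apply, Nat.sub_add_cancel hpq, hz0, iterate_zero, id]
    have := hx _ _ _ _ this
    omega
  refine ENNReal.eq_top_of_forall_nnreal_le fun r => ?_
  obtain ⟨m, hm⟩ := exists_nat_ge r
  refine le_trans (b := (m : ℝ≥0∞)) (by exact_mod_cast hm) ?_
  refine le_trans ?_ (le_iSup _ ((Finset.range m).image fun j => ⟨z 0 j, hmem 0 j⟩))
  refine le_limsup_encard_div (fun p j => ⟨z p j, hmem p j⟩) (fun p q i j h => ?_)
    fun n p hp j hj => ?_
  · have h := congrArg Subtype.val h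
    rcases le_total p q with hpq | hpq
    · exact key p q i j hpq h
    · have := key q p j i hpq h.symm
      exact ⟨this.1.symm, this.2.symm⟩
  · simp only [Set.mem_iUnion, Set.mem_preimage]
    refine ⟨p, hp, ?_⟩
    have : (surjCoverMap k)^[p] ⟨z p j, hmem p j⟩ = ⟨z 0 j, hmem 0 j⟩ :=
      Subtype.ext ((coe_surjCoverMap_iterate _ _ _).trans (hz0 p j))
    rw [this]
    simpa using ⟨j, hj, rfl⟩

theorem csetEntropy_eq_zero {k : A → A} {p q : ℕ} (hpq : p < q) (h : k^[p] = k^[q]) :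
    csetEntropy k = 0 := by
  have hper : ∀ x : surjCover k, IsPeriodicPt (surjCoverMap k) (q - p) x := fun x => by
    refine Subtype.ext ((coe_surjCoverMap_iterate _ _ _).trans ?_)
    -- The cover intersects ranges over n ≥ 1 only, so p + 1 also serves when p = 0.
    have hx := Set.mem_iInter₂.1 x.2 (p + 1) (by omega)
    obtain ⟨y, hy⟩ := hx
    rw [← hy, iterate_succ_apply, ← iterate_add_apply, Nat.sub_add_cancel hpq.le, h]
  refine le_antisymm (iSup_le fun D => le_of_eq ?_) (zero_le)
  refine limsup_encard_div_eq_zero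
    (E := ⋃ i < q - p, (surjCoverMap k)^[i] '' (D : Set (surjCover k)))
    ((Set.finite_lt_nat _).biUnion fun i _ => D.finite_toSet.image _) fun n => ?_
  refine Set.iUnion₂_subset fun i _ y hy => ?_
  -- With r = q - p the map has r-th power the identity, so its i-th inverse is its (r - 1)i-th
  -- power.
  refine Set.mem_iUnion₂.2 ⟨((q - p - 1) * i) % (q - p), Nat.mod_lt _ (by omega), _, hy, ?_⟩
  rw [((hper _).iterate_mod_apply), ← iterate_add_apply]
  have : (q - p - 1) * i + i = (q - p) * i := by
    obtain ⟨r, hr⟩ : ∃ r, q - p = r + 1 := ⟨q - p - 1, by omega⟩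
    rw [hr]; simp; ring
  rw [this]
  exact (hper y).mul_const i

end Growth

/-! ### Vanishing topological entropy -/

section Topological

variable {Γ Y : Type*} [Finite Y] [TopologicalSpace Y] [DiscreteTopology Y]

/-- Every open cover of `Y^Γ` is refined by the cylinders over some finite set of coordinates. -/
theorem exists_finset_cylinder_subset {𝒰 : Set (Set (Γ → Y))} (ho : ∀ U ∈ 𝒰, IsOpen U)
    (hc : ⋃₀ 𝒰 = Set.univ) :
    ∃ D : Finset Γ, ∀ x : Γ → Y, ∃ U ∈ 𝒰, ∀ y : Γ → Y, (∀ d ∈ D, y d = x d) → y ∈ U := by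
  classical
  have hloc : ∀ x : Γ → Y, ∃ D : Finset Γ, ∃ U ∈ 𝒰, ∀ y : Γ → Y, (∀ d ∈ D, y d = x d) → y ∈ U := by
    intro x
    obtain ⟨U, hU, hx⟩ := Set.mem_sUnion.1 (hc.symm ▸ Set.mem_univ x : x ∈ ⋃₀ 𝒰)
    obtain ⟨D, t, ht, hsub⟩ := isOpen_pi_iff.1 (ho U hU) x hx
    refine ⟨D, U, hU, fun y hy => hsub fun d hd => ?_⟩
    rw [hy d hd]
    exact (ht d hd).2
  choose D U hU hDU using hloc
  obtain ⟨t, -, ht⟩ := isCompact_univ.elim_nhds_subcover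
    (fun x : Γ → Y => (D x : Set Γ).pi fun d => {x d}) fun x _ =>
      (isOpen_set_pi (D x).finite_toSet fun d _ => isOpen_discrete _).mem_nhds fun d _ => rfl
  refine ⟨t.biUnion D, fun x => ?_⟩
  obtain ⟨x', hx', hxx'⟩ := Set.mem_iUnion₂.1 (ht (Set.mem_univ x))
  refine ⟨U x', hU x', fun y hy => hDU x' y fun d hd => ?_⟩
  rw [hy d (Finset.mem_biUnion.2 ⟨x', hx', hd⟩)]
  exact hxx' d hd

theorem iInter_preimage_mem_iterJoin {X : Type*} (T : X → X) {𝒰 : Set (Set X)} {s : ℕ → Set X}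
    (hs : ∀ i, s i ∈ 𝒰) (n : ℕ) : (⋂ i < n, T^[i] ⁻¹' s i) ∈ iterJoin T 𝒰 n := by
  induction n with
  | zero => simp [iterJoin]
  | succ n ih =>
    refine ⟨_, ih, _, ⟨s n, hs n, rfl⟩, ?_⟩
    rw [Set.biInter_lt_succ]

theorem topEntropy_shift_eq_zero {φ : Γ → Γ} (hφ : ∀ γ, ¬ Injective fun n => φ^[n] γ) :
    topEntropy (shift φ : (Γ → Y) → (Γ → Y)) = 0 := by
  classical
  refine le_antisymm (iSup₂_le fun 𝒰 h𝒰 => le_of_eq ?_) (zero_le)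
  obtain ⟨D, hD⟩ := exists_finset_cylinder_subset h𝒰.2.1 h𝒰.2.2
  choose V hV hVD using hD
  have horb : ∀ γ, (Set.range fun n => φ^[n] γ).Finite := fun γ => by
    obtain ⟨p, r, hr, h⟩ := exists_isPeriodicPt_iterate_of_finite hφ (Set.finite_singleton γ)
    have h := h γ rfl
    refine ((Set.finite_lt_nat (r + p)).image fun n => φ^[n] γ).subset ?_
    rintro _ ⟨n, rfl⟩
    obtain ⟨i, hi, hi'⟩ := exists_lt_iterate_eq (f := φ) (show p < r + p by omega) n
    refine ⟨i, hi, (hi' γ ?_).symm⟩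
    rw [iterate_add_apply]
    exact h.symm
  let E : Set Γ := ⋃ d ∈ D, Set.range fun n => φ^[n] d
  have hE : E.Finite := D.finite_toSet.biUnion fun d _ => horb d
  have : Finite E := hE
  have : Fintype (Set.range (E.domRestrict : (Γ → Y) → (E → Y))) := Fintype.ofFinite _
  let R := Set.range (E.domRestrict : (Γ → Y) → (E → Y))
  choose rep hrep using fun w : R => w.2
  refine limsup_log_div_eq_zero (C := Fintype.card R) fun n => ?_
  -- The itinerary of `rep w` selects one member of the join, which contains every point agreeing
  -- with w on the φ-invariant set E. Hence the bound `Fintype.card R` does not depend on n.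
  let W : R → Set (Γ → Y) := fun w => ⋂ i < n, (shift φ)^[i] ⁻¹' V ((shift φ)^[i] (rep w))
  have hle : ∃ 𝒲 : Finset (Set (Γ → Y)), (𝒲 : Set (Set (Γ → Y))) ⊆ iterJoin (shift φ) 𝒰 n ∧
      ⋃₀ (𝒲 : Set (Set (Γ → Y))) = Set.univ ∧ 𝒲.card = (Finset.univ.image W).card := by
    refine ⟨Finset.univ.image W, ?_, ?_, rfl⟩
    · simp only [Finset.coe_image, Finset.coe_univ, Set.image_univ]
      rintro _ ⟨w, rfl⟩
      exact iInter_preimage_mem_iterJoin _ (fun i => hV _) n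
    · refine Set.eq_univ_of_forall fun x => ?_
      let w : R := ⟨E.domRestrict x, x, rfl⟩
      refine ⟨W w, by simp, Set.mem_iInter₂.2 fun i _ => hVD _ _ fun d hd => ?_⟩
      have hmem : φ^[i] d ∈ E := Set.mem_iUnion₂.2 ⟨d, hd, i, rfl⟩
      rw [shift_iterate, shift_iterate]
      exact (congrFun (hrep w) ⟨_, hmem⟩).symm
  exact (Nat.sInf_le hle).trans Finset.card_image_le

end Topological

/-! ### Vanishing algebraic entropy -/

section Algebraic

variable {Γ Y : Type*} [Group Y]

theorem coe_directSumShift_iterate {φ : Γ → Γ} (hφ : FiniteFibre φ) (n : ℕ) (x : directSum Γ Y) :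
    ((directSumShift Y φ hφ)^[n] x).1 = x.1 ∘ φ^[n] := by
  rw [← shift_iterate]
  induction n generalizing x with
  | zero => rfl
  | succ n ih => rw [iterate_succ_apply, iterate_succ_apply, ih]; rfl

theorem algEntropy_directSumShift_eq_zero [Finite Y] {φ : Γ → Γ} (hφ : FiniteFibre φ) {p q : ℕ}
    (hpq : p < q) (h : φ^[p] = φ^[q]) : algEntropy (directSumShift Y φ hφ) = 0 := by
  refine le_antisymm (iSup₂_le fun H hH => le_of_eq ?_) (zero_le)
  -- F contains the supports of all shifts of elements of H, since every φ^n equals some φ^i with i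
  -- < q. The trajectories thus stay among the finitely many families supported in F.
  let F : Set Γ := ⋃ i < q, φ^[i] ⁻¹' ⋃ x ∈ H, {α | x.1 α ≠ 1}
  have hF : F.Finite := (Set.finite_lt_nat q).biUnion fun i _ =>
    (hH.biUnion fun x _ => x.2).preimage' fun b _ => hφ.iterate i b
  have : Finite F := hF
  let K : Set (directSum Γ Y) := {x | ∀ α ∉ F, x.1 α = 1}
  have hK : K.Finite := by
    refine Set.Finite.of_injOn (f := fun x : directSum Γ Y => F.domRestrict x.1)
      (Set.mapsTo_univ _ _) (fun x hx y hy hxy => ?_) Set.finite_univ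
    refine Subtype.ext (funext fun α => ?_)
    by_cases hα : α ∈ F
    · exact congrFun hxy ⟨α, hα⟩
    · rw [hx α hα, hy α hα]
  have hsub : ∀ n, trajectory (directSumShift Y φ hφ) H n ⊆ K := by
    intro n
    induction n with
    | zero =>
      rintro x hx α _
      rw [Set.mem_one.1 hx]
      rfl
    | succ n ih =>
      rintro _ ⟨x, hx, _, ⟨y, hy, rfl⟩, rfl⟩ α hα
      have hy1 : y.1 (φ^[n] α) = 1 := by
        by_contra hne
        obtain ⟨i, hi, hi'⟩ := exists_lt_iterate_eq (f := φ) hpq n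
        rw [hi' α (congrFun h α)] at hne
        exact hα (Set.mem_iUnion₂.2 ⟨i, hi, Set.mem_iUnion₂.2 ⟨y, hy, hne⟩⟩)
      change x.1 α * ((⇑(directSumShift Y φ hφ))^[n] y).1 α = 1
      rw [ih hx α hα, coe_directSumShift_iterate, comp_apply, hy1, one_mul]
  exact limsup_log_div_eq_zero fun n => Set.ncard_le_ncard (hsub n) hK

end Algebraic

/-! ### Infinite contravariant entropy from an infinite orbit -/

section InfiniteOrbit

variable {Γ : Type*} {φ : Γ → Γ}

/-- A height function along the grand orbit of a point with infinite forward orbit. -/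
theorem exists_height {α : Γ} (hα : Injective fun n => φ^[n] α) :
    ∃ H : Γ → Option ℤ, (∀ γ, H (φ γ) = (H γ).map (· + 1)) ∧ ∀ n : ℕ, H (φ^[n] α) = some (n : ℤ) := by
  classical
  -- The height l - k is well defined because α has an injective orbit; points off the grand orbit
  -- get `none`.
  let P : Γ → ℤ → Prop := fun γ d => ∃ k l : ℕ, φ^[k] γ = φ^[l] α ∧ d = l - k
  have huniq : ∀ γ d e, P γ d → P γ e → d = e := by
    rintro γ _ _ ⟨k, l, h, rfl⟩ ⟨k', l', h', rfl⟩
    have h1 : φ^[k' + l] α = φ^[k + l'] α := by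
      rw [iterate_add_apply, ← h, iterate_add_apply, ← h', ← iterate_add_apply,
        ← iterate_add_apply, add_comm]
    have := hα h1
    omega
  have hP : ∀ γ d, P (φ γ) (d + 1) ↔ P γ d := by
    refine fun γ d => ⟨?_, ?_⟩
    · rintro ⟨k, l, h, hd⟩
      exact ⟨k + 1, l, h, by push_cast; omega⟩
    · rintro ⟨k, l, h, hd⟩
      refine ⟨k, l + 1, ?_, by push_cast; omega⟩
      rw [← iterate_succ_apply, iterate_succ_apply', h, iterate_succ_apply']
  let H : Γ → Option ℤ := fun γ => if h : ∃ d, P γ d then some h.choose else none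
  have hH : ∀ γ d, P γ d → H γ = some d := fun γ d hd => by
    have hex : ∃ d, P γ d := ⟨d, hd⟩
    simp only [H, dif_pos hex]
    exact congrArg some (huniq γ _ _ hex.choose_spec hd)
  refine ⟨H, fun γ => ?_, fun n => hH _ _ ⟨0, n, rfl, by simp⟩⟩
  by_cases hex : ∃ d, P γ d
  · obtain ⟨d, hd⟩ := hex
    rw [hH _ _ hd, hH _ _ ((hP γ d).2 hd)]
    rfl
  · have hex' : ¬ ∃ d, P (φ γ) d := by
      rintro ⟨d, hd⟩
      exact hex ⟨d - 1, (hP γ _).1 (by simpa using hd)⟩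
    simp only [H, dif_neg hex, dif_neg hex', Option.map_none]

theorem csetEntropy_shift_eq_top {Y : Type*} [Finite Y] [Nontrivial Y] {α : Γ}
    (hα : Injective fun n => φ^[n] α) : csetEntropy (shift φ : (Γ → Y) → (Γ → Y)) = ⊤ := by
  obtain ⟨H, hH, hHα⟩ := exists_height hα
  have hsucc : ∀ n m : ℕ, Nat.succ^[n] m = m + n := fun n m => by
    rw [Nat.succ_iterate]
  obtain ⟨a, ha⟩ := exists_shift_independent (Y := Y) (φ := Nat.succ)
    (fun b => (Set.finite_singleton b).preimage (Nat.succ_injective.injOn))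
    (fun p q hpq => Set.infinite_univ.mono fun m _ => by
      simp only [Set.mem_ofPred_eq, hsucc]; omega)
  obtain ⟨y₀⟩ : Nonempty Y := inferInstance
  have hHn : ∀ (n : ℕ) γ, H (φ^[n] γ) = (H γ).map (· + (n : ℤ)) := by
    intro n γ
    induction n with
    | zero => simp
    | succ n ih =>
      rw [iterate_succ_apply', hH, ih, Option.map_map]
      congr 1
      funext d
      simp [add_assoc]
  -- The sequences a j on ℕ are read along the height, delayed by n: φ^m raises the height by m,
  -- which cancels m units of delay. Truncating negative arguments to 0 is harmless, as the integers
  -- agree beforehand. On the orbit of α, the undelayed point is a j itself.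
  refine csetEntropy_eq_top
    (fun n j γ => (H γ).elim y₀ fun d => a j (d - n).toNat) (fun m n j => ?_) fun p q i j h => ?_
  · funext γ
    rw [shift_iterate, comp_apply, hHn]
    cases H γ with
    | none => rfl
    | some d => simp [add_sub_add_right_eq_sub]
  · refine ha p q i j (funext fun n => ?_)
    have := congrFun h (φ^[n] α)
    simpa only [shift_iterate, comp_apply, ← iterate_add_apply, hHα, Option.elim_some, hsucc,
      Nat.cast_zero, sub_zero, Int.toNat_natCast, add_comm] using this

end InfiniteOrbit

end GenShift

theorem lemma4p3 {Γ Y : Type*} [Nonempty Γ] [Group Y] [Finite Y] [Nontrivial Y]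
    [TopologicalSpace Y] [DiscreteTopology Y] (φ : Γ → Γ)
    (hφ : GenShift.FiniteFibre φ)
    (hσ : GenShift.FiniteFibre (GenShift.shift φ : (Γ → Y) → (Γ → Y))) :
    -- the positivity classes are nested
    ((0 < GenShift.topEntropy (GenShift.shift φ : (Γ → Y) → (Γ → Y)) →
        0 < GenShift.csetEntropy (GenShift.shift φ : (Γ → Y) → (Γ → Y))) ∧
      (0 < GenShift.csetEntropy (GenShift.shift φ : (Γ → Y) → (Γ → Y)) →
        0 < GenShift.setEntropy (GenShift.shift φ : (Γ → Y) → (Γ → Y))) ∧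
      (0 < GenShift.algEntropy (GenShift.directSumShift Y φ hφ) →
        0 < GenShift.setEntropy (GenShift.shift φ : (Γ → Y) → (Γ → Y)))) ∧
    -- the inequalities
    (GenShift.topEntropy (GenShift.shift φ : (Γ → Y) → (Γ → Y)) ≤
        GenShift.csetEntropy (GenShift.shift φ : (Γ → Y) → (Γ → Y)) ∧
      GenShift.csetEntropy (GenShift.shift φ : (Γ → Y) → (Γ → Y)) ≤
        GenShift.setEntropy (GenShift.shift φ : (Γ → Y) → (Γ → Y)) ∧
      GenShift.algEntropy (GenShift.directSumShift Y φ hφ) ≤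
        GenShift.setEntropy (GenShift.shift φ : (Γ → Y) → (Γ → Y))) := by
  have main : GenShift.topEntropy (GenShift.shift φ : (Γ → Y) → (Γ → Y)) ≤
        GenShift.csetEntropy (GenShift.shift φ : (Γ → Y) → (Γ → Y)) ∧
      GenShift.csetEntropy (GenShift.shift φ : (Γ → Y) → (Γ → Y)) ≤
        GenShift.setEntropy (GenShift.shift φ : (Γ → Y) → (Γ → Y)) ∧
      GenShift.algEntropy (GenShift.directSumShift Y φ hφ) ≤
        GenShift.setEntropy (GenShift.shift φ : (Γ → Y) → (Γ → Y)) := by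
    by_cases horb : ∃ α, Function.Injective fun n => φ^[n] α
    · obtain ⟨α, hα⟩ := horb
      obtain ⟨x, hx⟩ := GenShift.exists_shift_independent (Y := Y) hφ fun p q hpq =>
        GenShift.infinite_iterate_ne_of_injective hα hpq
      rw [GenShift.csetEntropy_shift_eq_top hα, GenShift.setEntropy_eq_top x hx]
      exact ⟨le_top, le_top, le_top⟩
    · push Not at horb
      rw [GenShift.topEntropy_shift_eq_zero horb]
      refine ⟨zero_le, ?_⟩
      by_cases hper : ∃ p q, p < q ∧ φ^[p] = φ^[q]
      · obtain ⟨p, q, hpq, h⟩ := hper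
        rw [GenShift.csetEntropy_eq_zero hpq (funext fun x => by
          rw [GenShift.shift_iterate, GenShift.shift_iterate, h]),
          GenShift.algEntropy_directSumShift_eq_zero hφ hpq h]
        exact ⟨zero_le, zero_le⟩
      · push Not at hper
        obtain ⟨x, hx⟩ := GenShift.exists_shift_independent (Y := Y) hφ fun p q hpq =>
          GenShift.infinite_iterate_ne horb hper hpq
        rw [GenShift.setEntropy_eq_top x hx]
        exact ⟨le_top, le_top⟩
  exact ⟨⟨fun h => h.trans_le main.1, fun h => h.trans_le main.2.1,
    fun h => h.trans_le main.2.2⟩, main⟩
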